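/- Let $\mathcal A$ be a unital $C^*$-algebra and $\mathcal H$ a separable complex Hilbert space, and let $S_{\mathcal H}(\mathcal A)$ denote the set of all unital completely positive (UCP) linear maps $\mathcal A\to\mathcal B(\mathcal H)$. A completely positive map $\phi$ is called pure if every completely positive map $\psi$ such that $\phi-\psi$ is completely positive has the form $\psi=\lambda\phi$ with $\lambda\in[0,1]$. A map $\phi\in S_{\mathcal H}(\mathcal A)$ is called a $C^*$-extreme point of $S_{\mathcal H}(\mathcal A)$ if, whenever $\phi(\cdot)=\sum_{i=1}^n T_i^*\phi_i(\cdot)T_i$ with $\phi_i\in S_{\mathcal H}(\mathcal A)$ and invertible $T_i\in\mathcal B(\mathcal H)$ satisfying $\sum_{i=1}^n T_i^*T_i=I_{\mathcal H}$, there are unitaries $U_i\in\mathcal B(\mathcal H)$ with $\phi_i(\cdot)=U_i^*\phi(\cdot)U_i$ for each $i$. Suppose that $\phi\in S_{\mathcal H}(\mathcal A)$ decomposes as a direct sum of pure UCP maps, that is, $\mathcal H$ is a Hilbert space direct sum $\bigoplus_{i\in\Lambda}\mathcal H_i$ and there are pure UCP maps $\phi_i:\mathcal A\to\mathcal B(\mathcal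 H_i)$ such that $\phi(a)=\bigoplus_{i\in\Lambda}\phi_i(a)$ for all $a\in\mathcal A$. If $\phi$ is a $C^*$-extreme point of $S_{\mathcal H}(\mathcal A)$, then $\phi$ is also an extreme point of the convex set $S_{\mathcal H}(\mathcal A)$ in the usual linear sense. -/

import Mathlib

open scoped CStarAlgebra InnerProductSpace

section GeneralizedStates

variable {A : Type*} [CStarAlgebra A] [PartialOrder A] [StarOrderedRing A]
variable {H : Type*} [NormedAddCommGroup H] [InnerProductSpace ℂ H] [CompleteSpace H]

/-- A linear map `φ : A → B(H)` is completely positive if all its amplifications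
`Mₖ(A) → Mₖ(B(H))` (entrywise application of `φ`) are positive. It is the property that is bundled
in Mathlib's `A →CP (H →L[ℂ] H)`. -/
def IsCompletelyPositive (φ : A →ₗ[ℂ] (H →L[ℂ] H)) : Prop :=
  ∃ Φ : A →CP (H →L[ℂ] H), Φ.toLinearMap = φ

variable (A H) in
/-- The generalized state space `S_H(A)`: all unital completely positive maps `A → B(H)`. -/
def generalizedStateSpace : Set (A →ₗ[ℂ] (H →L[ℂ] H)) :=
  {φ | IsCompletelyPositive φ ∧ φ 1 = 1}

/-- A completely positive map `φ` is pure if every completely positive `ψ` with `ψ ≤ φ` (that is,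
`φ - ψ` completely positive) is of the form `t φ` with `t ∈ [0,1]`. -/
def IsPureCP (φ : A →ₗ[ℂ] (H →L[ℂ] H)) : Prop :=
  IsCompletelyPositive φ ∧
    ∀ ψ : A →ₗ[ℂ] (H →L[ℂ] H), IsCompletelyPositive ψ → IsCompletelyPositive (φ - ψ) →
      ∃ t ∈ Set.Icc (0 : ℝ) 1, ψ = t • φ

variable (A H) in
/-- The C*-extreme points of `S_H(A)`: whenever `φ = ∑ Tᵢ* φᵢ(·) Tᵢ` is a proper C*-convex
combination of elements `φᵢ` of `S_H(A)`, each `φᵢ` is unitarily equivalent to `φ`. -/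
def cStarExtremePoints : Set (A →ₗ[ℂ] (H →L[ℂ] H)) :=
  {φ | φ ∈ generalizedStateSpace A H ∧
    ∀ (n : ℕ) (T : Fin n → (H →L[ℂ] H)) (φs : Fin n → (A →ₗ[ℂ] (H →L[ℂ] H))),
      (∀ i, φs i ∈ generalizedStateSpace A H) →
      (∀ i, IsUnit (T i)) →
      ∑ i, star (T i) * T i = 1 →
      (∀ a, φ a = ∑ i, star (T i) * φs i a * T i) →
      ∀ i, ∃ U ∈ unitary (H →L[ℂ] H), ∀ a, φs i a = star U * φ a * U}

/-- `φ` is the direct sum `⨁ᵢ φs i` with respect to a decomposition of `H` as the Hilbert space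
direct sum of the `G i`, embedded by the isometries `V i`: each `φ a` acts as `φs i a` on the
`i`-th summand. The map `φ` is determined by this, because the summands span a dense subspace. -/
def IsDirectSumOfMaps {ι : Type*} {G : ι → Type*} [∀ i, NormedAddCommGroup (G i)]
    [∀ i, InnerProductSpace ℂ (G i)] (φ : A →ₗ[ℂ] (H →L[ℂ] H))
    (φs : ∀ i, A →ₗ[ℂ] (G i →L[ℂ] G i)) (V : ∀ i, G i →ₗᵢ[ℂ] H) : Prop :=
  IsHilbertSum ℂ G V ∧ ∀ (a : A) (i : ι) (x : G i), φ a (V i x) = V i (φs i a x)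

end GeneralizedStates

/-! ### Positivity of operator matrices as a quadratic form. -/

section BlockOperators

open scoped ComplexOrder
open ContinuousLinearMap

/-! Let `φ = s φ₁ + t φ₂` and `ψ = (φ₁ + φ) / 2`. Then `ψ` and `φ` dominate multiples of each other,
and `φ` is a proper convex combination of `ψ` and `φ₂`, so C*-extremality gives `ψ = U* φ U`. It
remains to prove `ψ = φ` (`IsDirectSumOfMaps.eq_of_unitarily_equivalent`).

If `X* φ X` and `Y* φ Y` are dominated by multiples of a pure unital `η`, purity and polarization
give `X* (ψ - φ) Y = 0` (`IsDominated.adjoint_comp_sub_comp_eq_zero`). Taking `X = Y = Vᵢ` kills the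
diagonal blocks of `ψ - φ`. Off the diagonal, put `Tₖᵢ = Vₖ* U Vᵢ`; by purity `Tₖᵢ* Tₖᵢ` is scalar.
If some `k` has `Tₖᵢ` and `Tₖⱼ` nonzero, the operators `Vᵢ Tₖᵢ*` and `Vⱼ Tₖⱼ*` are dominated by
`φₖ`, and the scalars can be cancelled. Otherwise the `(i, j)` blocks of `ψ` and `φ` both vanish. -/

theorem exists_eq_star_mul_self_of_nonneg {B : Type*} [NonUnitalCStarAlgebra B] [PartialOrder B]
    [StarOrderedRing B] {b : B} (hb : 0 ≤ b) : ∃ c : B, b = star c * c :=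
  CStarAlgebra.nonneg_iff_eq_star_mul_self.mp hb

/-- The `j`-th coordinate projection `Hⁿ → H` for the `ℓ²`-norm. -/
noncomputable def coordProj (H : Type*) [NormedAddCommGroup H] [InnerProductSpace ℂ H]
    {n : ℕ} (j : Fin n) : PiLp 2 (fun _ : Fin n => H) →L[ℂ] H :=
  PiLp.proj 2 (fun _ : Fin n => H) j

@[simp]
theorem coordProj_apply {H : Type*} [NormedAddCommGroup H] [InnerProductSpace ℂ H]
    {n : ℕ} (j : Fin n) (x : PiLp 2 (fun _ : Fin n => H)) :
    coordProj H j x = x j := rfl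

variable {H : Type*} [NormedAddCommGroup H] [InnerProductSpace ℂ H] [CompleteSpace H]

theorem adjoint_coordProj_apply {n : ℕ} (i j : Fin n) (x : H) :
    (adjoint (coordProj H j) x) i = if i = j then x else 0 := by
  refine ext_inner_right ℂ fun y => ?_
  have h := adjoint_inner_left (coordProj H j) (PiLp.single 2 i y) x
  rw [PiLp.inner_apply] at h
  rw [Finset.sum_eq_single i (fun k _ hk => by rw [PiLp.single_eq_of_ne 2 hk, inner_zero_right]) (by simp)] at h
  simp only [PiLp.single_eq_same, coordProj_apply] at h
  rw [h]
  split_ifs with hij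
  · subst hij; simp
  · rw [PiLp.single_eq_of_ne 2 (Ne.symm hij)]; simp

theorem sum_inner_coordProj {H : Type*} [NormedAddCommGroup H] [InnerProductSpace ℂ H] {n : ℕ} (x y : PiLp 2 (fun _ : Fin n => H)) :
    ∑ j, ⟪x j, y j⟫_ℂ = ⟪x, y⟫_ℂ := (PiLp.inner_apply _ _).symm

theorem cstarMatrix_star_mul_apply {B : Type*} [NonUnitalCStarAlgebra B] {n : ℕ}
    (M N : CStarMatrix (Fin n) (Fin n) B) (i j : Fin n) :
    (star M * N) i j = ∑ l, star (M l i) * N l j := rfl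

theorem inner_star_mul_cstarMatrix {n : ℕ} (N : CStarMatrix (Fin n) (Fin n) (H →L[ℂ] H))
    (i j : Fin n) (x y : H) :
    ⟪x, (star N * N) i j y⟫_ℂ = ∑ l, ⟪N l i x, N l j y⟫_ℂ := by
  rw [cstarMatrix_star_mul_apply, sum_apply, inner_sum]
  refine Finset.sum_congr rfl fun l _ => ?_
  rw [mul_apply_eq_comp, star_eq_adjoint, adjoint_inner_right]

theorem sum_sum_sum_rotate {α M : Type*} [Fintype α] [AddCommMonoid M] (f : α → α → α → M) :
    ∑ i, ∑ j, ∑ l, f l i j = ∑ l, ∑ i, ∑ j, f l i j := by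
  rw [Finset.sum_comm (f := fun l i => ∑ j, f l i j)]
  exact Finset.sum_congr rfl fun i _ => Finset.sum_comm

/-- A factorization `N* N` turns the form into a sum of squared norms. Conversely, the form defines
a positive operator `S* S` on `Hⁿ`, and the entries of `S` give `N`. -/
theorem cstarMatrix_nonneg_iff {n : ℕ} (M : CStarMatrix (Fin n) (Fin n) (H →L[ℂ] H)) :
    0 ≤ M ↔ ∀ x : Fin n → H, 0 ≤ ∑ i, ∑ j, ⟪x i, M i j (x j)⟫_ℂ := by
  constructor
  · intro hM x
    obtain ⟨N, rfl⟩ := exists_eq_star_mul_self_of_nonneg hM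
    have h : ∑ i, ∑ j, ⟪x i, (star N * N) i j (x j)⟫_ℂ =
        ∑ l, ⟪∑ i, N l i (x i), ∑ j, N l j (x j)⟫_ℂ := by
      simp only [inner_star_mul_cstarMatrix, inner_sum, sum_inner]
      rw [sum_sum_sum_rotate]
      exact Finset.sum_congr rfl fun l _ => Finset.sum_comm
    rw [h]
    exact Finset.sum_nonneg fun l _ =>
      Complex.nonneg_iff.mpr ⟨inner_self_nonneg (𝕜 := ℂ), (inner_self_im (𝕜 := ℂ) _).symm⟩
  · intro h
    set T : PiLp 2 (fun _ : Fin n => H) →L[ℂ] PiLp 2 (fun _ : Fin n => H) :=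
      ∑ i, ∑ j, adjoint (coordProj H i) ∘L M i j ∘L coordProj H j with hT
    have hform (x y : PiLp 2 (fun _ : Fin n => H)) :
        ⟪x, T y⟫_ℂ = ∑ i, ∑ j, ⟪x i, M i j (y j)⟫_ℂ := by
      simp [hT, adjoint_inner_right]
    have hpos : 0 ≤ T := by
      rw [nonneg_iff_isPositive, isPositive_iff_complex]
      intro x
      have h1 := h x
      rw [← hform] at h1
      have h2 := Complex.nonneg_iff.mp h1
      have e : ⟪T x, x⟫_ℂ = ⟪x, T x⟫_ℂ := by
        rw [← inner_conj_symm]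
        exact Complex.conj_eq_iff_im.mpr h2.2.symm
      rw [e]
      exact ⟨Complex.ext rfl h2.2, h2.1⟩
    obtain ⟨S, hS⟩ := exists_eq_star_mul_self_of_nonneg hpos
    set N : CStarMatrix (Fin n) (Fin n) (H →L[ℂ] H) := CStarMatrix.ofMatrix fun i j =>
        coordProj H i ∘L S ∘L adjoint (coordProj H j) with hN
    have hM : M = star N * N := by
      refine CStarMatrix.ext fun i j => ?_
      refine ContinuousLinearMap.ext fun x => ext_inner_left ℂ fun y => ?_
      have h1 : ⟪adjoint (coordProj H i) y, T (adjoint (coordProj H j) x)⟫_ℂ = ⟪y, M i j x⟫_ℂ := by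
        rw [hform, Finset.sum_eq_single i, Finset.sum_eq_single j]
        · simp [adjoint_coordProj_apply]
        · intro k _ hk; simp [adjoint_coordProj_apply, hk]
        · simp
        · intro k _ hk; simp [adjoint_coordProj_apply, hk]
        · simp
      rw [← h1, hS, mul_apply_eq_comp, star_eq_adjoint, adjoint_inner_right,
        inner_star_mul_cstarMatrix, ← sum_inner_coordProj]
      rfl
    rw [hM]
    exact star_mul_self_nonneg _

end BlockOperators

/-! ### Complete positivity through quadratic forms. -/

section Criterion

open scoped ComplexOrder
open ContinuousLinearMap

variable {A : Type*} [CStarAlgebra A] [PartialOrder A] [StarOrderedRing A]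
variable {H : Type*} [NormedAddCommGroup H] [InnerProductSpace ℂ H] [CompleteSpace H]

theorem cstarMatrix_of_star_mul_nonneg {n : ℕ} (a : Fin n → A) :
    (0 : CStarMatrix (Fin n) (Fin n) A) ≤ CStarMatrix.ofMatrix fun i j => star (a i) * a j := by
  rcases n with _ | n
  · exact le_of_eq (CStarMatrix.ext fun i => i.elim0)
  · have : (CStarMatrix.ofMatrix fun i j : Fin (n + 1) => star (a i) * a j) =
        star (CStarMatrix.ofMatrix fun i j : Fin (n + 1) => if i = 0 then a j else 0) *
        CStarMatrix.ofMatrix fun i j : Fin (n + 1) => if i = 0 then a j else 0 := by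
      refine CStarMatrix.ext fun i j => ?_
      rw [cstarMatrix_star_mul_apply]
      change star (a i) * a j = ∑ l : Fin (n + 1), star (if l = 0 then a i else 0) *
        (if l = 0 then a j else 0)
      rw [Finset.sum_eq_single 0 (fun l _ hl => by simp [hl]) (by simp)]
      simp
    rw [this]
    exact star_mul_self_nonneg _

/-- A positive matrix `N* N` is the sum, over the rows of `N`, of matrices `(aᵢ* aⱼ)`. -/
theorem isCompletelyPositive_iff {φ : A →ₗ[ℂ] (H →L[ℂ] H)} :
    IsCompletelyPositive φ ↔ ∀ (n : ℕ) (a : Fin n → A) (x : Fin n → H),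
      0 ≤ ∑ i, ∑ j, ⟪x i, φ (star (a i) * a j) (x j)⟫_ℂ := by
  constructor
  · rintro ⟨Φ, rfl⟩ n a x
    exact (cstarMatrix_nonneg_iff _).mp
      (Φ.map_cstarMatrix_nonneg' n _ (cstarMatrix_of_star_mul_nonneg a)) x
  · intro h
    refine ⟨⟨φ, fun n M hM => ?_⟩, rfl⟩
    rw [cstarMatrix_nonneg_iff]
    intro x
    obtain ⟨N, rfl⟩ := exists_eq_star_mul_self_of_nonneg hM
    have : ∑ i, ∑ j, ⟪x i, φ ((star N * N) i j) (x j)⟫_ℂ =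
        ∑ l, ∑ i, ∑ j, ⟪x i, φ (star (N l i) * N l j) (x j)⟫_ℂ := by
      simp only [cstarMatrix_star_mul_apply, map_sum, sum_apply, inner_sum]
      exact sum_sum_sum_rotate _
    exact (Finset.sum_nonneg fun l _ => h n (N l) x).trans_eq this.symm

theorem IsCompletelyPositive.map_star {φ : A →ₗ[ℂ] (H →L[ℂ] H)} (hφ : IsCompletelyPositive φ)
    (a : A) : φ (star a) = star (φ a) := by
  obtain ⟨Φ, rfl⟩ := hφ
  have hsa (b : A) (hb : IsSelfAdjoint b) : star (Φ.toLinearMap b) = Φ.toLinearMap b :=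
    (hb.map' Φ).star_eq
  have h1 := hsa _ (realPart a).2
  have h2 := hsa _ (imaginaryPart a).2
  have e : star a = (realPart a : A) - Complex.I • (imaginaryPart a : A) := by
    conv_lhs => rw [← realPart_add_I_smul_imaginaryPart a]
    rw [star_add, star_smul, (realPart a).2.star_eq, (imaginaryPart a).2.star_eq]
    simp [sub_eq_add_neg]
  conv_rhs => rw [← realPart_add_I_smul_imaginaryPart a]
  rw [e, map_sub, map_smul, map_add, map_smul, star_add, star_smul, h1, h2]
  simp [sub_eq_add_neg]

end Criterion

/-! ### Compressions, domination and purity. -/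

section Compression

open scoped ComplexOrder
open ContinuousLinearMap

variable {A : Type*} [CStarAlgebra A]
variable {H : Type*} [NormedAddCommGroup H] [InnerProductSpace ℂ H] [CompleteSpace H]
variable {G : Type*} [NormedAddCommGroup G] [InnerProductSpace ℂ G] [CompleteSpace G]
variable {K : Type*} [NormedAddCommGroup K] [InnerProductSpace ℂ K] [CompleteSpace K]

/-- The map `a ↦ X* φ(a) X`. -/
noncomputable def compression (X : G →L[ℂ] H) (φ : A →ₗ[ℂ] (H →L[ℂ] H)) :
    A →ₗ[ℂ] (G →L[ℂ] G) where
  toFun a := adjoint X ∘L φ a ∘L X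
  map_add' a b := by ext; simp
  map_smul' c a := by ext; simp

theorem compression_apply (X : G →L[ℂ] H) (φ : A →ₗ[ℂ] (H →L[ℂ] H)) (a : A) :
    compression X φ a = adjoint X ∘L φ a ∘L X := rfl

theorem compression_compression (X : G →L[ℂ] H) (Y : K →L[ℂ] G) (φ : A →ₗ[ℂ] (H →L[ℂ] H)) :
    compression Y (compression X φ) = compression (X ∘L Y) φ := by
  ext a x
  simp [compression_apply, adjoint_comp]

theorem compression_sub (X : G →L[ℂ] H) (φ ψ : A →ₗ[ℂ] (H →L[ℂ] H)) :
    compression X (φ - ψ) = compression X φ - compression X ψ := by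
  ext a x
  simp [compression_apply]

theorem compression_smul (X : G →L[ℂ] H) (c : ℝ) (φ : A →ₗ[ℂ] (H →L[ℂ] H)) :
    compression X (c • φ) = c • compression X φ := by
  ext a x
  simp [compression_apply]

variable [PartialOrder A] [StarOrderedRing A]

theorem isCompletelyPositive_zero : IsCompletelyPositive (0 : A →ₗ[ℂ] (H →L[ℂ] H)) :=
  isCompletelyPositive_iff.mpr fun n a x => by simp

theorem IsCompletelyPositive.add {φ ψ : A →ₗ[ℂ] (H →L[ℂ] H)} (hφ : IsCompletelyPositive φ)
    (hψ : IsCompletelyPositive ψ) : IsCompletelyPositive (φ + ψ) := by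
  rw [isCompletelyPositive_iff] at *
  intro n a x
  simpa [inner_add_right, Finset.sum_add_distrib] using add_nonneg (hφ n a x) (hψ n a x)

theorem IsCompletelyPositive.smul {φ : A →ₗ[ℂ] (H →L[ℂ] H)} (hφ : IsCompletelyPositive φ)
    {c : ℝ} (hc : 0 ≤ c) : IsCompletelyPositive (c • φ) := by
  rw [isCompletelyPositive_iff] at *
  intro n a x
  have hc' : (0 : ℂ) ≤ c := by exact_mod_cast hc
  have := mul_nonneg hc' (hφ n a x)
  simpa only [Finset.mul_sum, LinearMap.smul_apply, smul_apply, inner_smul_right_eq_smul,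
    Complex.real_smul] using this

theorem IsCompletelyPositive.compression {φ : A →ₗ[ℂ] (H →L[ℂ] H)}
    (hφ : IsCompletelyPositive φ) (X : G →L[ℂ] H) : IsCompletelyPositive (compression X φ) := by
  rw [isCompletelyPositive_iff] at *
  intro n a x
  simpa [compression_apply, adjoint_inner_right] using hφ n a fun i => X (x i)

theorem IsPureCP.eq_smul_of_le {φ ψ : A →ₗ[ℂ] (H →L[ℂ] H)} (hφ : IsPureCP φ)
    (hψ : IsCompletelyPositive ψ) {c : ℝ} (hc : 0 < c) (h : IsCompletelyPositive (c • φ - ψ)) :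
    ∃ s : ℝ, ψ = s • φ := by
  have hc' : 0 ≤ c⁻¹ := inv_nonneg.mpr hc.le
  obtain ⟨t, -, ht⟩ := hφ.2 (c⁻¹ • ψ) (hψ.smul hc') <| by
    have := h.smul hc'
    rwa [smul_sub, inv_smul_smul₀ hc.ne'] at this
  exact ⟨c * t, by rw [mul_smul, ← ht, smul_inv_smul₀ hc.ne']⟩

/-- `X* φ(·) X` is dominated by a multiple of `η` in the order of complete positivity. -/
def IsDominated (X : G →L[ℂ] H) (φ : A →ₗ[ℂ] (H →L[ℂ] H)) (η : A →ₗ[ℂ] (G →L[ℂ] G)) : Prop :=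
  ∃ c : ℝ, 0 < c ∧ IsCompletelyPositive (c • η - compression X φ)

variable {φ ψ : A →ₗ[ℂ] (H →L[ℂ] H)} {η : A →ₗ[ℂ] (G →L[ℂ] G)} {X Y : G →L[ℂ] H}

theorem IsDominated.add (hφ : IsCompletelyPositive φ) (hX : IsDominated X φ η)
    (hY : IsDominated Y φ η) : IsDominated (X + Y) φ η := by
  obtain ⟨c, hc, h⟩ := hX
  obtain ⟨d, hd, h'⟩ := hY
  refine ⟨2 * c + 2 * d, by positivity, ?_⟩
  -- Parallelogram law: the compressions by `X + Y` and `X - Y` add up to twice those by `X` and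
  -- `Y`.
  have e : (2 * c + 2 * d) • η - _root_.compression (X + Y) φ =
      (2 : ℝ) • (c • η - _root_.compression X φ) + (2 : ℝ) • (d • η - _root_.compression Y φ) +
        _root_.compression (X - Y) φ := by
    ext a x
    simp only [compression_apply, LinearMap.sub_apply, LinearMap.add_apply, LinearMap.smul_apply,
      map_add, map_sub, sub_apply, add_apply, smul_apply, coe_comp, Function.comp_apply]
    module
  rw [e]
  exact ((h.smul zero_le_two).add (h'.smul zero_le_two)).add (hφ.compression _)

theorem IsDominated.smul (hX : IsDominated X φ η) {z : ℂ}
    (hz : ‖z‖ = 1) : IsDominated (z • X) φ η := by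
  obtain ⟨c, hc, h⟩ := hX
  refine ⟨c, hc, ?_⟩
  convert h using 2
  ext a x
  have : (starRingEnd ℂ) z * z = 1 := by
    rw [Complex.conj_mul', hz]; simp
  have hadj : adjoint (z • X) = starRingEnd ℂ z • adjoint X := map_smulₛₗ _ _ _
  simp [compression_apply, hadj, smul_smul, mul_comm z, this]

theorem IsDominated.proj_comp (hφ : IsCompletelyPositive φ) {P : H →L[ℂ] H}
    (hP : IsSelfAdjoint P) (hPP : P * P = P) (hPφ : ∀ a, P * φ a = φ a * P)
    (hX : IsDominated X φ η) : IsDominated (P ∘L X) φ η := by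
  obtain ⟨c, hc, h⟩ := hX
  refine ⟨c, hc, ?_⟩
  have e : c • η - _root_.compression (P ∘L X) φ =
      c • η - _root_.compression X φ + _root_.compression ((1 - P) ∘L X) φ := by
    -- A projection commuting with `φ` splits it into two diagonal blocks.
    have e1 : _root_.compression X φ =
        _root_.compression (P ∘L X) φ + _root_.compression ((1 - P) ∘L X) φ := by
      ext a x
      have h1 : φ a = P * φ a * P + (1 - P) * φ a * (1 - P) := by
        have : P * φ a * P = φ a * P := by rw [hPφ, mul_assoc, hPP]
        rw [mul_sub, mul_one, sub_mul, one_mul, sub_mul, this, hPφ]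
        abel
      have hP' : adjoint P = P := hP
      have h2 : adjoint (1 - P) = 1 - P := (IsSelfAdjoint.one _).sub hP
      have h3 := congrArg (fun T : H →L[ℂ] H => adjoint X (T (X x))) h1
      simpa only [compression_apply, LinearMap.add_apply, add_apply, adjoint_comp, hP', h2,
        coe_comp, Function.comp_apply, mul_apply_eq_comp, map_add] using h3
    rw [e1]
    abel
  rw [e]
  exact h.add (hφ.compression _)

theorem IsDominated.exists_compression_eq_smul (hη : IsPureCP η) (hφ : IsCompletelyPositive φ)
    (hX : IsDominated X φ η) : ∃ s : ℝ, _root_.compression X φ = s • η := by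
  obtain ⟨c, hc, h⟩ := hX
  exact hη.eq_smul_of_le (hφ.compression X) hc h

/-- By purity both compressions are multiples of `η`, and both take the value `X* X` at `1`. -/
theorem IsDominated.compression_eq (hη : IsPureCP η) (hη1 : η 1 = 1)
    (hφ : φ ∈ generalizedStateSpace A H) (hψ : ψ ∈ generalizedStateSpace A H)
    {c : ℝ} (hc : 0 < c) (hle : IsCompletelyPositive (c • φ - ψ)) (hX : IsDominated X φ η) :
    _root_.compression X ψ = _root_.compression X φ := by
  obtain ⟨s, hs⟩ := hX.exists_compression_eq_smul hη hφ.1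
  have hX' : IsDominated X ψ η := by
    obtain ⟨d, hd, h⟩ := hX
    refine ⟨c * d, by positivity, ?_⟩
    have e : (c * d) • η - _root_.compression X ψ =
        c • (d • η - _root_.compression X φ) + _root_.compression X (c • φ - ψ) := by
      rw [compression_sub, compression_smul]
      module
    rw [e]
    exact (h.smul hc.le).add (hle.compression X)
  obtain ⟨t, ht⟩ := hX'.exists_compression_eq_smul hη hψ.1
  -- The scalars themselves need not agree when `G` is trivial.
  have h1 : s • (1 : G →L[ℂ] G) = t • 1 := by
    have h2 := LinearMap.congr_fun hs 1
    have h3 := LinearMap.congr_fun ht 1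
    rw [compression_apply, hφ.2, LinearMap.smul_apply, hη1] at h2
    rw [compression_apply, hψ.2, LinearMap.smul_apply, hη1] at h3
    rw [← h2, ← h3]
  rw [hs, ht]
  ext a x
  have := congrArg (fun T : G →L[ℂ] G => T (η a x)) h1
  simpa using this.symm

/-- Polarization: the diagonal case is applied to `X`, `Y`, `X + Y` and `X + iY`. -/
theorem IsDominated.adjoint_comp_sub_comp_eq_zero (hη : IsPureCP η) (hη1 : η 1 = 1)
    (hφ : φ ∈ generalizedStateSpace A H) (hψ : ψ ∈ generalizedStateSpace A H)
    {c : ℝ} (hc : 0 < c) (hle : IsCompletelyPositive (c • φ - ψ)) (hX : IsDominated X φ η)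
    (hY : IsDominated Y φ η) (a : A) : adjoint X ∘L (ψ a - φ a) ∘L Y = 0 := by
  have key {Z : G →L[ℂ] H} (hZ : IsDominated Z φ η) (x : G) :
      adjoint Z ((ψ a - φ a) (Z x)) = 0 := by
    have := congrArg (fun T => T a x) (hZ.compression_eq hη hη1 hφ hψ hc hle)
    simpa [compression_apply, sub_eq_zero] using this
  ext x
  have hIY := hY.smul (z := Complex.I) (by simp)
  have h1 := key (hX.add hφ.1 hY) x
  have h2 := key (hX.add hφ.1 hIY) x
  have h3 := key hX x
  have h4 := key hY x
  simp only [map_add, add_apply, map_smulₛₗ, smul_apply, h3, h4, smul_zero, add_zero,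
    zero_add, Complex.conj_I, RingHom.id_apply] at h1 h2
  set p := adjoint X ((ψ a - φ a) (Y x))
  set q := adjoint Y ((ψ a - φ a) (X x))
  have hpq : p = q := by
    have : Complex.I • (p - q) = 0 := by
      rw [← h2]
      module
    exact sub_eq_zero.mp ((smul_eq_zero.mp this).resolve_left Complex.I_ne_zero)
  have h5 : (2 : ℂ) • p = 0 := by
    rw [← h1, ← hpq, two_smul]
  exact (smul_eq_zero.mp h5).resolve_left two_ne_zero

end Compression

/-! ### Testing vectors and operators on the summands. -/

section HilbertSum

open ContinuousLinearMap

variable {H : Type*} [NormedAddCommGroup H] [InnerProductSpace ℂ H] [CompleteSpace H]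
variable {ι : Type*} {G : ι → Type*} [∀ i, NormedAddCommGroup (G i)]
  [∀ i, InnerProductSpace ℂ (G i)] {V : ∀ i, G i →ₗᵢ[ℂ] H}

theorem IsHilbertSum.inner_linearIsometryEquiv_apply (hV : IsHilbertSum ℂ G V) (i : ι) (x : G i)
    (u : H) : ⟪x, hV.linearIsometryEquiv u i⟫_ℂ = ⟪V i x, u⟫_ℂ := by
  classical
  rw [← lp.inner_single_left, ← hV.linearIsometryEquiv.symm.inner_map_map,
    hV.linearIsometryEquiv_symm_apply_single, LinearIsometryEquiv.symm_apply_apply]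

theorem IsHilbertSum.eq_zero_of_forall_inner (hV : IsHilbertSum ℂ G V) {u : H}
    (hu : ∀ i x, ⟪V i x, u⟫_ℂ = 0) : u = 0 := by
  rw [← hV.linearIsometryEquiv.map_eq_zero_iff]
  ext i
  exact ext_inner_left ℂ fun x => by
    rw [hV.inner_linearIsometryEquiv_apply, hu]; simp

theorem IsHilbertSum.inner_eq_zero_of_forall [∀ i, CompleteSpace (G i)]
    (hV : IsHilbertSum ℂ G V) {u w : H}
    (h : ∀ i, ⟪adjoint (V i).toContinuousLinearMap u, adjoint (V i).toContinuousLinearMap w⟫_ℂ = 0) :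
    ⟪u, w⟫_ℂ = 0 := by
  have hadj (i : ι) (v : H) :
      hV.linearIsometryEquiv v i = adjoint (V i).toContinuousLinearMap v :=
    ext_inner_left ℂ fun x => by
      rw [hV.inner_linearIsometryEquiv_apply, adjoint_inner_right]; rfl
  rw [← hV.linearIsometryEquiv.inner_map_map, lp.inner_eq_tsum]
  simp [hadj, h]

theorem IsHilbertSum.operator_eq_zero (hV : IsHilbertSum ℂ G V) {D : H →L[ℂ] H}
    (hD : ∀ i j x y, ⟪V i x, D (V j y)⟫_ℂ = 0) : D = 0 := by
  have h1 (j : ι) (y : G j) : D (V j y) = 0 := hV.eq_zero_of_forall_inner fun i x => hD i j x y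
  have h2 : adjoint D = 0 := by
    ext w
    exact hV.eq_zero_of_forall_inner fun j y => by rw [adjoint_inner_right, h1, inner_zero_left]
  rw [← adjoint_adjoint D, h2, map_zero]

end HilbertSum

/-! ### Rigidity of direct sums of pure maps. -/

section DirectSum

open ContinuousLinearMap

variable {A : Type*} [CStarAlgebra A]
variable {H : Type*} [NormedAddCommGroup H] [InnerProductSpace ℂ H] [CompleteSpace H]
variable {ι : Type*} {G : ι → Type*} [∀ i, NormedAddCommGroup (G i)]
  [∀ i, InnerProductSpace ℂ (G i)] [∀ i, CompleteSpace (G i)]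

theorem LinearIsometry.adjoint_apply_self {G : Type*} [NormedAddCommGroup G]
    [InnerProductSpace ℂ G] [CompleteSpace G] (V : G →ₗᵢ[ℂ] H) (x : G) :
    adjoint V.toContinuousLinearMap (V x) = x :=
  ext_inner_left ℂ fun y => by
    rw [adjoint_inner_right]; exact V.inner_map_map y x

variable {φ ψ : A →ₗ[ℂ] (H →L[ℂ] H)} {φs : ∀ i, A →ₗ[ℂ] (G i →L[ℂ] G i)}
  {V : ∀ i, G i →ₗᵢ[ℂ] H}

theorem IsDirectSumOfMaps.compression_eq (hSum : IsDirectSumOfMaps φ φs V) (i : ι) :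
    compression (V i).toContinuousLinearMap φ = φs i := by
  ext a x
  have := hSum.2 a i x
  simp [compression_apply, this, LinearIsometry.adjoint_apply_self]

variable [PartialOrder A] [StarOrderedRing A]

theorem IsDirectSumOfMaps.adjoint_apply (hSum : IsDirectSumOfMaps φ φs V)
    (hφ : IsCompletelyPositive φ) (hφs : ∀ i, IsCompletelyPositive (φs i)) (a : A) (i : ι) (u : H) :
    adjoint (V i).toContinuousLinearMap (φ a u) =
      φs i a (adjoint (V i).toContinuousLinearMap u) := by
  refine ext_inner_left ℂ fun x => ?_
  have h1 := hφ.map_star (star a)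
  have h2 := (hφs i).map_star (star a)
  rw [star_star, star_eq_adjoint] at h1 h2
  rw [h1, h2, adjoint_inner_right, adjoint_inner_right, adjoint_inner_right, adjoint_inner_right]
  congr 1
  exact hSum.2 (star a) i x

theorem IsDirectSumOfMaps.isDominated (hSum : IsDirectSumOfMaps φ φs V) (i : ι) :
    IsDominated (V i).toContinuousLinearMap φ (φs i) :=
  ⟨1, one_pos, by rw [hSum.compression_eq, one_smul, sub_self]; exact isCompletelyPositive_zero⟩

theorem IsDirectSumOfMaps.isDominated_proj_comp (hSum : IsDirectSumOfMaps φ φs V)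
    (hφ : IsCompletelyPositive φ) (hφs : ∀ i, IsCompletelyPositive (φs i)) (i : ι)
    {K : Type*} [NormedAddCommGroup K] [InnerProductSpace ℂ K] [CompleteSpace K]
    {η : A →ₗ[ℂ] (K →L[ℂ] K)} {X : K →L[ℂ] H} (hX : IsDominated X φ η) :
    IsDominated ((V i).toContinuousLinearMap ∘L adjoint (V i).toContinuousLinearMap ∘L X) φ η := by
  have := hX.proj_comp hφ
    (P := (V i).toContinuousLinearMap ∘L adjoint (V i).toContinuousLinearMap) ?_ ?_ ?_
  · exact this
  · rw [IsSelfAdjoint, star_eq_adjoint, adjoint_comp, adjoint_adjoint]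
  · ext x
    simp [LinearIsometry.adjoint_apply_self]
  · intro a
    ext x
    simp [hSum.adjoint_apply hφ hφs, hSum.2]

/-- Two unital completely positive maps that dominate multiples of each other and are unitarily
equivalent coincide, if one of them is a direct sum of pure maps. -/
theorem IsDirectSumOfMaps.eq_of_unitarily_equivalent (hSum : IsDirectSumOfMaps φ φs V)
    (hφ : φ ∈ generalizedStateSpace A H) (hψ : ψ ∈ generalizedStateSpace A H)
    (hφs : ∀ i, φs i ∈ generalizedStateSpace A (G i)) (hPure : ∀ i, IsPureCP (φs i))
    {c d : ℝ} (hc : 0 < c) (hle : IsCompletelyPositive (c • φ - ψ))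
    (hd : 0 < d) (hge : IsCompletelyPositive (d • ψ - φ))
    {U : H →L[ℂ] H} (hU : U ∈ unitary (H →L[ℂ] H)) (hψU : ∀ a, ψ a = star U * φ a * U) :
    ψ = φ := by
  have hCP (i) : IsCompletelyPositive (φs i) := (hφs i).1
  set W : ∀ i, G i →L[ℂ] H := fun i => (V i).toContinuousLinearMap with hW
  have hWW (i : ι) (x : G i) : adjoint (W i) (W i x) = x :=
    LinearIsometry.adjoint_apply_self (V i) x
  set T : ∀ k i, G i →L[ℂ] G k := fun k i => adjoint (W k) ∘L U ∘L W i with hT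
  have hψc : ψ = compression U φ := by
    ext a x
    simp [hψU, compression_apply, star_eq_adjoint]
  have hψc' : compression (adjoint U) ψ = φ := by
    rw [hψc, compression_compression]
    have : U ∘L adjoint U = 1 := (Unitary.mem_iff.mp hU).2
    rw [this]
    ext a x
    have h1 : adjoint (1 : H →L[ℂ] H) = 1 := star_one _
    simp [compression_apply, h1]
  have hdom1 (i : ι) : IsDominated (U ∘L W i) φ (φs i) := by
    refine ⟨c, hc, ?_⟩
    rw [← compression_compression, ← hψc]
    have := hle.compression (W i)
    rwa [compression_sub, compression_smul, hSum.compression_eq] at this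
  -- Here `φ ≤ d ψ` is used: compressing `ψ` by `U*` returns `φ`.
  have hdom2 (k : ι) : IsDominated (adjoint U ∘L W k) φ (φs k) := by
    refine ⟨d, hd, ?_⟩
    have := hge.compression (adjoint U ∘L W k)
    rwa [compression_sub, compression_smul, ← compression_compression, hψc',
      hSum.compression_eq] at this
  have hscal (k i : ι) : ∃ s : ℝ, ∀ x, adjoint (T k i) (T k i x) = s • x := by
    obtain ⟨s, hs⟩ := (hSum.isDominated_proj_comp hφ.1 hCP k
      (hdom1 i)).exists_compression_eq_smul (hPure i) hφ.1
    refine ⟨s, fun x => ext_inner_left ℂ fun y => ?_⟩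
    have h1 := congrArg (fun f => ⟪y, f 1 x⟫_ℂ) hs
    simp only [compression_apply, hφ.2, LinearMap.smul_apply, (hφs i).2, coe_comp,
      Function.comp_apply, adjoint_inner_right] at h1
    rw [adjoint_inner_right]
    exact ((V k).inner_map_map _ _).symm.trans h1
  have hzero (k i j : ι) (a : A) :
      T k i ∘L adjoint (W i) ∘L (ψ a - φ a) ∘L W j ∘L adjoint (T k j) = 0 := by
    have := (hSum.isDominated_proj_comp hφ.1 hCP i
      (hdom2 k)).adjoint_comp_sub_comp_eq_zero (hPure k) (hφs k).2 hφ hψ hc hle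
        (hSum.isDominated_proj_comp hφ.1 hCP j (hdom2 k)) a
    simpa [hT, hW, adjoint_comp, comp_assoc] using this
  have hblock (i j : ι) (a : A) : adjoint (W i) ∘L (ψ a - φ a) ∘L W j = 0 := by
    classical
    by_cases hij : i = j
    · subst hij
      exact (hSum.isDominated i).adjoint_comp_sub_comp_eq_zero (hPure i) (hφs i).2 hφ hψ hc hle
        (hSum.isDominated i) a
    by_cases hk : ∃ k, T k i ≠ 0 ∧ T k j ≠ 0
    · obtain ⟨k, hi, hj⟩ := hk
      obtain ⟨s, hs⟩ := hscal k i
      obtain ⟨t, ht⟩ := hscal k j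
      have hne {l : ι} (hl : T k l ≠ 0) {r : ℝ} (hr : ∀ x, adjoint (T k l) (T k l x) = r • x) :
          r ≠ 0 := by
        rintro rfl
        refine hl (ContinuousLinearMap.ext fun x => ?_)
        rw [zero_apply, ← inner_self_eq_zero (𝕜 := ℂ), ← adjoint_inner_right, hr]
        simp
      ext x
      -- Multiplying by `Tₖᵢ*` on the left and `Tₖⱼ` on the right leaves the block times `s t`.
      have := congrArg (fun S => adjoint (T k i) (S (T k j x))) (hzero k i j a)
      have h0 : t • s • adjoint (W i) ((ψ a - φ a) (W j x)) = 0 := by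
        simpa [hs, ht, smul_sub] using this
      exact (smul_eq_zero.mp ((smul_eq_zero.mp h0).resolve_left (hne hj ht))).resolve_left
        (hne hi hs)
    · push Not at hk
      ext y
      refine ext_inner_left ℂ fun x => ?_
      -- Every term `Tₖᵢ* φₖ(a) Tₖⱼ` of the `ψ` block has a zero factor.
      have h1 : ⟪U (W i x), φ a (U (W j y))⟫_ℂ = 0 := by
        refine hSum.1.inner_eq_zero_of_forall fun k => ?_
        rw [hSum.adjoint_apply hφ.1 hCP]
        change ⟪T k i x, φs k a (T k j y)⟫_ℂ = 0
        by_cases hi : T k i = 0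
        · simp [hi]
        · simp [hk k hi]
      have h2 : ⟪W i x, φ a (W j y)⟫_ℂ = 0 := by
        have : φ a (W j y) = V j (φs j a y) := hSum.2 a j y
        rw [this]
        exact hSum.1.OrthogonalFamily hij _ _
      simp [adjoint_inner_right, hψU, star_eq_adjoint, h1, h2, inner_sub_right]
  refine LinearMap.ext fun a => sub_eq_zero.mp (hSum.1.operator_eq_zero fun i j x y => ?_)
  have := congrArg (fun S => ⟪x, S y⟫_ℂ) (hblock i j a)
  simpa [adjoint_inner_right, hW] using this

end DirectSum

/-! ### Convex combinations and C*-extremality. -/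

section CStarExtreme

variable {A : Type*} [CStarAlgebra A] [PartialOrder A] [StarOrderedRing A]
variable {H : Type*} [NormedAddCommGroup H] [InnerProductSpace ℂ H] [CompleteSpace H]

/-- The scalar operators `√s` and `√t` serve as invertible C*-coefficients. -/
theorem exists_unitary_of_mem_cStarExtremePoints {φ φ₁ φ₂ : A →ₗ[ℂ] (H →L[ℂ] H)}
    (hφ : φ ∈ cStarExtremePoints A H) (h₁ : φ₁ ∈ generalizedStateSpace A H)
    (h₂ : φ₂ ∈ generalizedStateSpace A H) {s t : ℝ} (hs : 0 < s) (ht : 0 < t) (hst : s + t = 1)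
    (h : s • φ₁ + t • φ₂ = φ) :
    ∃ U ∈ unitary (H →L[ℂ] H), ∀ a, φ₁ a = star U * φ a * U := by
  have hstar (r : ℝ) (S : H →L[ℂ] H) (hr : 0 < r) :
      star (√r • (1 : H →L[ℂ] H)) * S * (√r • (1 : H →L[ℂ] H)) = r • S := by
    rw [star_smul, star_one, smul_mul_assoc, one_mul, mul_smul_comm, mul_one, smul_smul]
    simp [Real.mul_self_sqrt hr.le]
  have hunit (r : ℝ) (hr : 0 < r) : IsUnit (√r • (1 : H →L[ℂ] H)) := by
    rw [← Algebra.algebraMap_eq_smul_one]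
    exact (IsUnit.mk0 _ (Real.sqrt_pos.mpr hr).ne').map (algebraMap ℝ (H →L[ℂ] H))
  refine hφ.2 2 ![√s • 1, √t • 1] ![φ₁, φ₂] ?_ ?_ ?_ ?_ 0
  · simp [Fin.forall_fin_two, h₁, h₂]
  · simpa [Fin.forall_fin_two] using ⟨hunit s hs, hunit t ht⟩
  · have e1 := hstar s 1 hs
    have e2 := hstar t 1 ht
    rw [mul_one] at e1 e2
    rw [Fin.sum_univ_two]
    change star (√s • (1 : H →L[ℂ] H)) * (√s • 1) + star (√t • (1 : H →L[ℂ] H)) * (√t • 1) = 1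
    rw [e1, e2, ← add_smul, hst, one_smul]
  · intro a
    rw [Fin.sum_univ_two, ← h]
    exact (congrArg₂ (· + ·) (hstar s (φ₁ a) hs) (hstar t (φ₂ a) ht)).symm

theorem generalizedStateSpace_convex : Convex ℝ (generalizedStateSpace A H) := by
  intro φ hφ ψ hψ s t hs ht hst
  refine ⟨(hφ.1.smul hs).add (hψ.1.smul ht), ?_⟩
  rw [LinearMap.add_apply, LinearMap.smul_apply, LinearMap.smul_apply, hφ.2, hψ.2, ← add_smul,
    hst, one_smul]

end CStarExtreme

theorem mainTheorem9 {A : Type*} [CStarAlgebra A] [PartialOrder A] [StarOrderedRing A]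
    {H : Type*} [NormedAddCommGroup H] [InnerProductSpace ℂ H] [CompleteSpace H]
    [TopologicalSpace.SeparableSpace H]
    {ι : Type*} {G : ι → Type*} [∀ i, NormedAddCommGroup (G i)]
    [∀ i, InnerProductSpace ℂ (G i)] [∀ i, CompleteSpace (G i)]
    (φ : A →ₗ[ℂ] (H →L[ℂ] H))
    (φs : ∀ i, A →ₗ[ℂ] (G i →L[ℂ] G i)) (V : ∀ i, G i →ₗᵢ[ℂ] H)
    (hUCP : ∀ i, φs i ∈ generalizedStateSpace A (G i))
    (hPure : ∀ i, IsPureCP (φs i))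
    (hSum : IsDirectSumOfMaps φ φs V)
    (hExt : φ ∈ cStarExtremePoints A H) :
    φ ∈ (generalizedStateSpace A H).extremePoints ℝ := by
  refine mem_extremePoints_iff_left.mpr ⟨hExt.1, ?_⟩
  rintro φ₁ h₁ φ₂ h₂ ⟨s, t, hs, ht, hst, h⟩
  -- Averaging with `φ` ensures `φ ≤ 2 ψ`, which `φ₁` alone need not satisfy.
  set ψ : A →ₗ[ℂ] (H →L[ℂ] H) := (2⁻¹ : ℝ) • φ₁ + (2⁻¹ : ℝ) • φ with hψ
  have hψS : ψ ∈ generalizedStateSpace A H :=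
    generalizedStateSpace_convex h₁ hExt.1 (by norm_num) (by norm_num) (by norm_num)
  have hs' : 0 < 1 + s := by linarith
  have hcomb : (2 * s / (1 + s)) • ψ + (t / (1 + s)) • φ₂ = φ := by
    have e : (1 + s) • φ = (2 * s) • ψ + t • φ₂ := by
      rw [add_smul, one_smul, hψ]
      nth_rewrite 1 [← h]
      module
    rw [← inv_smul_smul₀ hs'.ne' φ, e]
    module
  obtain ⟨U, hU, hψU⟩ := exists_unitary_of_mem_cStarExtremePoints hExt hψS h₂
    (by positivity) (by positivity) (by field_simp; linarith) hcomb
  have hge : IsCompletelyPositive ((2 : ℝ) • ψ - φ) := by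
    convert h₁.1 using 1
    rw [hψ]
    module
  -- The constant comes from `φ₁ ≤ s⁻¹ φ`, with room to spare.
  have hle : IsCompletelyPositive ((1 + s⁻¹) • φ - ψ) := by
    have e : (1 + s⁻¹) • φ - ψ =
        (2⁻¹ : ℝ) • φ + ((2⁻¹ : ℝ) • φ₁ + (s⁻¹ * t) • φ₂) := by
      rw [add_smul, one_smul, hψ]
      nth_rewrite 2 [← h]
      rw [smul_add, smul_smul, smul_smul, inv_mul_cancel₀ hs.ne']
      module
    rw [e]
    exact (hExt.1.1.smul (by norm_num)).add
      ((h₁.1.smul (by norm_num)).add (h₂.1.smul (by positivity)))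
  have := hSum.eq_of_unitarily_equivalent hExt.1 hψS hUCP hPure (by positivity) hle two_pos hge
    hU hψU
  have e : φ₁ = (2 : ℝ) • ψ - φ := by
    rw [hψ]
    module
  rw [e, this]
  module
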